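/- Let $\mathcal H,\mathcal K$ be complex Hilbert spaces and let $A\in B(\mathcal H)^d$, $B\in B(\mathcal K)^d$ be $d$-tuples of bounded operators. Norms of tuples are maxima over the entries: $\|X-Y\|=\max_i\|X_i-Y_i\|$. For a tuple $A$, let $C^*(A)$ be the unital C*-subalgebra of $B(\mathcal H)$ generated by $A_1,\dots,A_d$, and for $n\ge 1$ let $$\mathcal W_n(A)=\{(\varphi(A_1),\dots,\varphi(A_d)) : \varphi\colon C^*(A)\to M_n(\mathbb C)\ \text{unital completely positive}\}$$ be the $n$-th level of its matrix range. The one-sided matrix range distance and the matrix range distance are $$d_{\mathrm{mr}}(A\to B)=\sup_{n\ge 1}\ \sup_{X\in\mathcal W_n(A)}\ \inf_{Y\in\mathcal W_n(B)}\|X-Y\|,\qquad d_{\mathrm{mr}}(A,B)=\sup_{n\ge 1} d_{\mathrm H}\bigl(\mathcal W_n(A),\mathcal W_n(B)\bigr)=\max\{d_{\mathrm{mr}}(A\to B),d_{\mathrm{mr}}(B\to A)\},$$ where $d_{\mathrm H}$ is the Hausdorff distance. Write $A\sim A'$ if there is a $*$-isomorphism $C^*(A)\to C^*(A')$ mapping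 $A_i$ to $A'_i$ for all $i$. Write $C\prec B$ if there are a Hilbert space $\mathcal L$, a closed subspace $\mathcal M\subseteq\mathcal L$, and tuples $U\in B(\mathcal M)^d$, $V\in B(\mathcal L)^d$ with $C\sim U$, $B\sim V$ and $U_i=P_{\mathcal M}V_i|_{\mathcal M}$ for all $i$. The one-sided relaxed dilation distance and the relaxed dilation distance are $$d_{\mathrm{rD}}(A\to B)=\inf\{\|A'-C\| : A',C\in B(\mathcal L)^d \text{ for some Hilbert space }\mathcal L,\ A'\sim A,\ C\prec B\},\qquad d_{\mathrm{rD}}(A,B)=\max\{d_{\mathrm{rD}}(A\to B),d_{\mathrm{rD}}(B\to A)\}.$$ All these quantities take values in $[0,\infty]$, with $\sup\emptyset=0$ and $\inf\emptyset=\infty$. Then $$d_{\mathrm{mr}}(A\to B)=d_{\mathrm{rD}}(A\to B)\qquad\text{and}\qquad d_{\mathrm{mr}}(A,B)=d_{\mathrm{rD}}(A,B).$$ -/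

import Mathlib

universe u

noncomputable section

namespace OperatorTuple

variable {d : ℕ}
variable {H : Type u} [NormedAddCommGroup H] [InnerProductSpace ℂ H] [CompleteSpace H]
variable {K : Type u} [NormedAddCommGroup K] [InnerProductSpace ℂ K] [CompleteSpace K]

/-- `C*(A)`: the unital C*-subalgebra of `B(H)` generated by the operators `A 0, …, A (d - 1)`. -/
def cstar (A : Fin d → H →L[ℂ] H) : StarSubalgebra ℂ (H →L[ℂ] H) :=
  (StarAlgebra.adjoin ℂ (Set.range A)).topologicalClosure

instance isClosed_cstar (A : Fin d → H →L[ℂ] H) :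
    IsClosed (cstar A : Set (H →L[ℂ] H)) :=
  StarSubalgebra.isClosed_topologicalClosure _

/-- The operator `A i`, viewed as an element of `C*(A)`. -/
def gen (A : Fin d → H →L[ℂ] H) (i : Fin d) : cstar A :=
  ⟨A i, StarSubalgebra.le_topologicalClosure _
    (StarAlgebra.subset_adjoin ℂ _ (Set.mem_range_self i))⟩

/-- The order that `C*(A)` inherits from the order of `B(H)` is its order as a C*-algebra. -/
instance starOrderedRing_cstar (A : Fin d → H →L[ℂ] H) : StarOrderedRing (cstar A) := by
  refine StarOrderedRing.of_nonneg_iff' (fun {x y} hxy z => ?_) (fun x => ⟨fun hx => ?_, ?_⟩)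
  · exact add_le_add_right (α := H →L[ℂ] H) hxy z
  · have hx' : (0 : H →L[ℂ] H) ≤ x := hx
    have h1 : IsSelfAdjoint x := Subtype.ext (IsSelfAdjoint.of_nonneg hx').star_eq
    have h2 : SpectrumRestricts x ContinuousMap.realToNNReal := by
      rw [SpectrumRestricts.nnreal_iff]
      intro r hr
      refine spectrum_nonneg_of_nonneg hx' ?_
      rw [← spectrum.preimage_algebraMap ℂ] at hr ⊢
      rwa [Set.mem_preimage, StarSubalgebra.spectrum_eq] at hr
    obtain ⟨s, hs, -, hsx⟩ := CFC.exists_sqrt_of_isSelfAdjoint_of_quasispectrumRestricts h1 h2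
    exact ⟨s, by rw [hs.star_eq, hsx]⟩
  · rintro ⟨s, rfl⟩
    exact star_mul_self_nonneg (s : H →L[ℂ] H)

/-- `M_n`, realized as the C*-algebra of operators on the Hilbert space `ℂⁿ`. -/
abbrev Mat (n : ℕ) : Type := EuclideanSpace ℂ (Fin n) →L[ℂ] EuclideanSpace ℂ (Fin n)

/-- The `n`-th level `W_n(A) = {φ(A) : φ ∈ UCP(C*(A), M_n)}` of the matrix range of `A`. -/
def matrixRange (n : ℕ) (A : Fin d → H →L[ℂ] H) : Set (Fin d → Mat n) :=
  {X | ∃ φ : CompletelyPositiveMap (cstar A) (Mat n), φ 1 = 1 ∧ ∀ i, φ (gen A i) = X i}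

/-- The one-sided matrix range distance. The norm of a tuple is the largest norm of an entry. -/
def dmrTo (A : Fin d → H →L[ℂ] H) (B : Fin d → K →L[ℂ] K) : ENNReal :=
  ⨆ (n : ℕ) (_ : 1 ≤ n), ⨆ X ∈ matrixRange n A, ⨅ Y ∈ matrixRange n B, ‖X - Y‖ₑ

/-- The matrix range distance: the supremum over all levels of the Hausdorff distance. -/
def dmr (A : Fin d → H →L[ℂ] H) (B : Fin d → K →L[ℂ] K) : ENNReal :=
  ⨆ (n : ℕ) (_ : 1 ≤ n), Metric.hausdorffEDist (matrixRange n A) (matrixRange n B)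

/-- The matrix range distance is the larger one of the two one-sided distances. -/
theorem dmr_eq_max (A : Fin d → H →L[ℂ] H) (B : Fin d → K →L[ℂ] K) :
    dmr A B = max (dmrTo A B) (dmrTo B A) := by
  simp only [dmr, dmrTo, Metric.hausdorffEDist_def, Metric.infEDist, edist_eq_enorm_sub,
    iSup_sup_eq]

/-- `A ∼ B`: some *-isomorphism `C*(A) → C*(B)` maps `A i` to `B i` for all `i`. -/
def Equivalent (A : Fin d → H →L[ℂ] H) (B : Fin d → K →L[ℂ] K) : Prop :=
  ∃ φ : cstar A ≃⋆ₐ[ℂ] cstar B, ∀ i, φ (gen A i) = gen B i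

/-- `A ≺ B`: there are a Hilbert space `L`, a closed subspace `M` of `L`, and tuples `U ∼ A` on `M`
and `V ∼ B` on `L` such that `U` is the compression of `V` to `M`. -/
def DilatesTo (A : Fin d → H →L[ℂ] H) (B : Fin d → K →L[ℂ] K) : Prop :=
  ∃ (L : Type u) (_ : NormedAddCommGroup L) (_ : InnerProductSpace ℂ L) (_ : CompleteSpace L)
    (M : Submodule ℂ L) (_ : CompleteSpace M) (U : Fin d → M →L[ℂ] M) (V : Fin d → L →L[ℂ] L),
    Equivalent A U ∧ Equivalent B V ∧
      ∀ i, U i = M.orthogonalProjectionOnto ∘L V i ∘L M.subtypeL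

/-- The one-sided relaxed dilation distance: the infimum of `‖A' - C‖` over all Hilbert spaces `L`
and all tuples `A' ∼ A` and `C ≺ B` on `L`. -/
def drDTo (A : Fin d → H →L[ℂ] H) (B : Fin d → K →L[ℂ] K) : ENNReal :=
  sInf {r | ∃ (L : Type u) (_ : NormedAddCommGroup L) (_ : InnerProductSpace ℂ L)
    (_ : CompleteSpace L) (A' C : Fin d → L →L[ℂ] L),
    Equivalent A A' ∧ DilatesTo C B ∧ r = ‖A' - C‖ₑ}

/-- The relaxed dilation distance. -/
def drD (A : Fin d → H →L[ℂ] H) (B : Fin d → K →L[ℂ] K) : ENNReal :=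
  max (drDTo A B) (drDTo B A)

end OperatorTuple

end

/-!
Both inequalities between the one-sided distances rest on the structure of unital completely
positive (UCP) maps; the two-sided identity follows by symmetry.

If `A' ∼ A` and `C ≺ B` act on the same space, Arveson's extension theorem turns a UCP map
`C*(A) → M_n` into a UCP map `Φ` on the whole operator algebra. Then `Φ(C)` lies in `W_n(B)`, and it
is at distance at most `‖A' - C‖` from `Φ(A')` because UCP maps are contractive.

Conversely, suppose that the matrix range distance is less than `t`. The compression of `A` to a
finite-dimensional subspace of `H` belongs to the matrix range of `A`, so it is `t`-close to the
image of `B` under a UCP map. A weak limit of these maps along an ultrafilter on the finite subsets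
of `H` is a UCP map `ψ : C*(B) → B(H)` with `‖A i - ψ(B i)‖ ≤ t`. The direct sum of its Stinespring
representation and the identity representation is faithful, and it shows that `ψ(B) ≺ B`.

Positivity of an extension is obtained from the M. Riesz extension theorem, applied to the cone of
elements with nonnegative real part; Arveson's theorem reduces to it because completely positive
maps into `M_n` correspond to positive functionals on `n × n` matrices.
-/

noncomputable section

namespace OperatorTuple

open scoped InnerProductSpace ComplexOrder ComplexConjugate CStarAlgebra

theorem map_nonneg_iff_of_injective {S T : Type*}
    [NonUnitalCStarAlgebra S] [PartialOrder S] [StarOrderedRing S]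
    [NonUnitalCStarAlgebra T] [PartialOrder T] [StarOrderedRing T]
    (φ : S →⋆ₙₐ[ℂ] T) (hφ : Function.Injective φ) {a : S} : 0 ≤ φ a ↔ 0 ≤ a := by
  refine ⟨fun h => ?_, fun h => map_nonneg φ h⟩
  have hφa : IsSelfAdjoint (φ a) := .of_nonneg h
  have ha : IsSelfAdjoint a := hφ (by rw [map_star, hφa.star_eq])
  refine (CFC.negPart_eq_zero_iff a).1 (hφ ?_)
  rw [map_zero, ← (CFC.negPart_eq_zero_iff (φ a)).2 h, CFC.negPart_def, CFC.negPart_def]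
  exact NonUnitalStarAlgHomClass.map_cfcₙ (S := ℂ) φ _ a
    (hφ := NonUnitalStarAlgHom.isometry φ hφ |>.continuous)

theorem operator_nonneg_iff {E : Type*} [NormedAddCommGroup E] [InnerProductSpace ℂ E]
    {T : E →L[ℂ] E} : 0 ≤ T ↔ ∀ x, 0 ≤ ⟪x, T x⟫_ℂ := by
  rw [ContinuousLinearMap.nonneg_iff_isPositive]
  refine ⟨fun h => h.inner_nonneg_right,
    fun h => (ContinuousLinearMap.isPositive_iff_complex T).2 fun x => ?_⟩
  obtain ⟨hre, him⟩ := Complex.nonneg_iff.1 (h x)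
  rw [← inner_conj_symm, Complex.conj_eq_iff_im.2 him.symm]
  exact ⟨Complex.ext rfl him, hre⟩

section OperatorMatrix

variable {ι : Type*} [Fintype ι]
variable {E : Type*} [NormedAddCommGroup E] [InnerProductSpace ℂ E]

/-- The operator on `E^ι` given by a matrix of operators on `E`. -/
def blockOperator (M : CStarMatrix ι ι (E →L[ℂ] E)) :
    PiLp 2 (fun _ : ι => E) →L[ℂ] PiLp 2 (fun _ : ι => E) :=
  (PiLp.continuousLinearEquiv 2 ℂ (fun _ : ι => E)).symm ∘L
    (ContinuousLinearMap.pi fun i => ∑ j, M i j ∘L PiLp.proj 2 (fun _ : ι => E) j)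

theorem blockOperator_apply (M : CStarMatrix ι ι (E →L[ℂ] E)) (x : PiLp 2 fun _ : ι => E)
    (i : ι) : blockOperator M x i = ∑ j, M i j (x j) := by
  simp [blockOperator]

theorem inner_blockOperator (M : CStarMatrix ι ι (E →L[ℂ] E)) (x y : PiLp 2 fun _ : ι => E) :
    ⟪x, blockOperator M y⟫_ℂ = ∑ i, ∑ j, ⟪x i, M i j (y j)⟫_ℂ := by
  simp only [PiLp.inner_apply, blockOperator_apply, inner_sum]

theorem blockOperator_injective : Function.Injective (blockOperator (ι := ι) (E := E)) := by
  classical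
  intro M N h
  ext i j v
  simpa [blockOperator_apply, Pi.single_apply, apply_ite] using
    congr($h (PiLp.single 2 j v) i)

variable [CompleteSpace E]

variable (ι E) in
/-- `blockOperator` as a representation of the C*-algebra of operator matrices. -/
def blockRepresentation : CStarMatrix ι ι (E →L[ℂ] E) →⋆ₙₐ[ℂ]
    (PiLp 2 (fun _ : ι => E) →L[ℂ] PiLp 2 (fun _ : ι => E)) where
  toFun := blockOperator
  map_smul' c M := by ext x i; simp [blockOperator_apply, Finset.smul_sum]
  map_zero' := by ext x i; simp [blockOperator_apply]
  map_add' M N := by ext x i; simp [blockOperator_apply, Finset.sum_add_distrib]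
  map_mul' M N := by
    ext x i
    simp only [blockOperator_apply, mul_apply_eq_comp, CStarMatrix.mul_apply, sum_apply, map_sum]
    exact Finset.sum_comm
  map_star' M := by
    ext1 y
    refine ext_inner_left ℂ fun x => ?_
    rw [ContinuousLinearMap.star_eq_adjoint, ContinuousLinearMap.adjoint_inner_right,
      inner_blockOperator, Finset.sum_comm]
    simp only [CStarMatrix.star_apply, ContinuousLinearMap.star_eq_adjoint,
      ContinuousLinearMap.adjoint_inner_right, PiLp.inner_apply, blockOperator_apply, sum_inner]

theorem cstarMatrix_nonneg_iff {M : CStarMatrix ι ι (E →L[ℂ] E)} :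
    0 ≤ M ↔ ∀ x : ι → E, 0 ≤ ∑ i, ∑ j, ⟪x i, M i j (x j)⟫_ℂ := by
  rw [← map_nonneg_iff_of_injective (blockRepresentation ι E) blockOperator_injective,
    operator_nonneg_iff]
  exact ⟨fun h x => (inner_blockOperator M _ _).symm ▸ h (WithLp.toLp 2 x),
    fun h x => (inner_blockOperator M x x).symm ▸ h x⟩

end OperatorMatrix

section CompletelyPositive

variable {S : Type*} [NonUnitalCStarAlgebra S]
variable {E : Type*} [NormedAddCommGroup E] [InnerProductSpace ℂ E] [CompleteSpace E]
variable {ι : Type*}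

/-- The Gram matrix `(aᵢ⋆ aⱼ)` of a family in a C*-algebra. -/
def gramMatrix (a : ι → S) : CStarMatrix ι ι S := .ofMatrix (.of fun i j => star (a i) * a j)

theorem gramMatrix_apply (a : ι → S) (i j : ι) : gramMatrix a i j = star (a i) * a j := rfl

variable [PartialOrder S] [StarOrderedRing S] [Fintype ι]

theorem gramMatrix_nonneg (a : ι → S) : 0 ≤ gramMatrix a := by
  classical
  rcases isEmpty_or_nonempty ι with _ | ⟨⟨i₀⟩⟩
  · exact (CStarMatrix.ext fun i => isEmptyElim i : _ = _).le
  let R : CStarMatrix ι ι S := .ofMatrix (.of fun l j => if l = i₀ then a j else 0)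
  have hR : gramMatrix a = star R * R := by
    ext i j
    simp [gramMatrix_apply, CStarMatrix.mul_apply, CStarMatrix.star_apply, R]
  exact hR ▸ star_mul_self_nonneg R

theorem sum_inner_map_nonneg (φ : S →CP (E →L[ℂ] E)) {M : CStarMatrix ι ι S} (hM : 0 ≤ M)
    (x : ι → E) : 0 ≤ ∑ i, ∑ j, ⟪x i, φ (M i j) (x j)⟫_ℂ :=
  cstarMatrix_nonneg_iff.1 (φ.map_cstarMatrix_nonneg M hM) x

theorem sum_inner_map_star_mul_nonneg (φ : S →CP (E →L[ℂ] E)) (a : ι → S) (x : ι → E) :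
    0 ≤ ∑ i, ∑ j, ⟪x i, φ (star (a i) * a j) (x j)⟫_ℂ :=
  sum_inner_map_nonneg φ (gramMatrix_nonneg a) x

/-- The completely positive map given by a linear map with nonnegative quadratic forms. -/
def cpOfQuadraticForm (φ : S →ₗ[ℂ] (E →L[ℂ] E))
    (hφ : ∀ (k : ℕ) (a : Fin k → S) (x : Fin k → E),
      0 ≤ ∑ i, ∑ j, ⟪x i, φ (star (a i) * a j) (x j)⟫_ℂ) : S →CP (E →L[ℂ] E) where
  toLinearMap := φ
  map_cstarMatrix_nonneg' k M hM := by
    refine cstarMatrix_nonneg_iff.2 fun x => ?_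
    rw [StarOrderedRing.nonneg_iff] at hM
    induction hM using AddSubmonoid.closure_induction with
    | zero => simp
    | add M N _ _ hM hN =>
      simpa [inner_add_right, Finset.sum_add_distrib] using add_nonneg hM hN
    | mem M hM =>
      obtain ⟨R, rfl⟩ := hM
      have hsum : ∑ i, ∑ j, ⟪x i, φ ((star R * R) i j) (x j)⟫_ℂ =
          ∑ l, ∑ i, ∑ j, ⟪x i, φ (star (R l i) * R l j) (x j)⟫_ℂ := by
        simp only [CStarMatrix.mul_apply, CStarMatrix.star_apply, map_sum, sum_apply, inner_sum]
        exact (Finset.sum_congr rfl fun i _ => Finset.sum_comm).trans Finset.sum_comm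
      exact hsum ▸ Finset.sum_nonneg fun l _ => hφ k (R l) x

/-- The composition of completely positive maps. -/
def cpComp {S₁ S₂ S₃ : Type*}
    [NonUnitalCStarAlgebra S₁] [PartialOrder S₁] [StarOrderedRing S₁]
    [NonUnitalCStarAlgebra S₂] [PartialOrder S₂] [StarOrderedRing S₂]
    [NonUnitalCStarAlgebra S₃] [PartialOrder S₃] [StarOrderedRing S₃]
    (ψ : S₂ →CP S₃) (φ : S₁ →CP S₂) : S₁ →CP S₃ where
  toLinearMap := ψ.toLinearMap ∘ₗ φ.toLinearMap
  map_cstarMatrix_nonneg' _ M hM :=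
    ψ.map_cstarMatrix_nonneg _ (φ.map_cstarMatrix_nonneg M hM)

theorem cpComp_apply {S₁ S₂ S₃ : Type*}
    [NonUnitalCStarAlgebra S₁] [PartialOrder S₁] [StarOrderedRing S₁]
    [NonUnitalCStarAlgebra S₂] [PartialOrder S₂] [StarOrderedRing S₂]
    [NonUnitalCStarAlgebra S₃] [PartialOrder S₃] [StarOrderedRing S₃]
    (ψ : S₂ →CP S₃) (φ : S₁ →CP S₂) (s : S₁) : cpComp ψ φ s = ψ (φ s) := rfl

/-- The completely positive map given by a ⋆-homomorphism. -/
def cpOfHom {S₁ S₂ : Type*}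
    [CStarAlgebra S₁] [PartialOrder S₁] [StarOrderedRing S₁]
    [CStarAlgebra S₂] [PartialOrder S₂] [StarOrderedRing S₂]
    (π : S₁ →⋆ₐ[ℂ] S₂) : S₁ →CP S₂ := π

variable {E' : Type*} [NormedAddCommGroup E'] [InnerProductSpace ℂ E'] [CompleteSpace E']

/-- The completely positive map `T ↦ J⋆ T J`. -/
def compress (J : E →L[ℂ] E') : (E' →L[ℂ] E') →CP (E →L[ℂ] E) :=
  cpOfQuadraticForm
    { toFun T := J.adjoint ∘L T ∘L J
      map_add' _ _ := by ext; simp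
      map_smul' _ _ := by ext; simp }
    fun k a x => by
      have hsq : 0 ≤ ⟪∑ i, a i (J (x i)), ∑ i, a i (J (x i))⟫_ℂ := by
        rw [inner_self_eq_norm_sq_to_K]
        positivity
      rw [Finset.sum_comm]
      simpa only [LinearMap.coe_mk, AddHom.coe_mk, ContinuousLinearMap.comp_apply,
        ContinuousLinearMap.adjoint_inner_right, mul_apply_eq_comp,
        ContinuousLinearMap.star_eq_adjoint, sum_inner, inner_sum] using hsq

theorem inner_compress (J : E →L[ℂ] E') (T : E' →L[ℂ] E') (x y : E) :
    ⟪x, compress J T y⟫_ℂ = ⟪J x, T (J y)⟫_ℂ :=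
  ContinuousLinearMap.adjoint_inner_right J x (T (J y))

theorem compress_one (V : E →ₗᵢ[ℂ] E') : compress V.toContinuousLinearMap 1 = 1 := by
  ext1 y
  refine ext_inner_left ℂ fun x => ?_
  rw [inner_compress]
  exact V.inner_map_map x y

theorem norm_compress_le {J : E →L[ℂ] E'} (hJ : ‖J‖ ≤ 1) (T : E' →L[ℂ] E') :
    ‖compress J T‖ ≤ ‖T‖ :=
  calc ‖compress J T‖ ≤ ‖J.adjoint‖ * (‖T‖ * ‖J‖) :=
        (ContinuousLinearMap.opNorm_comp_le _ _).trans <| by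
          gcongr; exact ContinuousLinearMap.opNorm_comp_le _ _
    _ ≤ 1 * (‖T‖ * 1) := by
        gcongr
        rwa [LinearIsometryEquiv.norm_map]
    _ = ‖T‖ := by ring

end CompletelyPositive

section Krein

open scoped ComplexStarModule

theorem exists_nonneg_extension {V W : Type*} [AddCommGroup V] [Module ℝ V]
    [AddCommGroup W] [Module ℝ W] (C : PointedCone ℝ W) {i : V →ₗ[ℝ] W}
    (hi : Function.Injective i) (g : V →ₗ[ℝ] ℝ) (hg : ∀ v, i v ∈ C → 0 ≤ g v)
    (hC : ∀ w, ∃ v, i v + w ∈ C) :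
    ∃ G : W →ₗ[ℝ] ℝ, (∀ v, G (i v) = g v) ∧ ∀ w ∈ C, 0 ≤ G w := by
  let e := LinearEquiv.ofInjective i hi
  obtain ⟨G, hGg, hG⟩ := riesz_extension C ⟨LinearMap.range i, g ∘ₗ e.symm.toLinearMap⟩
    (by
      intro w hw
      obtain ⟨v, rfl⟩ := e.surjective w
      simpa using hg v hw)
    (fun w => (hC w).imp' e fun v hv => hv)
  exact ⟨G, fun v => (hGg (e v)).trans (by simp), hG⟩

variable {S T : Type*} [CStarAlgebra S] [PartialOrder S] [StarOrderedRing S]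
  [CStarAlgebra T] [PartialOrder T] [StarOrderedRing T]

variable (T) in
/-- The cone of accretive elements: those with nonnegative real part. -/
def accretiveCone : PointedCone ℝ T where
  carrier := {t | 0 ≤ (ℜ t : T)}
  add_mem' ha hb := by simpa using add_nonneg (α := T) ha hb
  zero_mem' := by simp
  smul_mem' c t ht := by simpa using! smul_nonneg c.2 ht

theorem mem_accretiveCone_iff {t : T} : t ∈ accretiveCone T ↔ 0 ≤ (ℜ t : T) := Iff.rfl

theorem exists_algebraMap_add_mem_accretiveCone (t : T) :
    ∃ c : ℝ, algebraMap ℝ T c + t ∈ accretiveCone T := by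
  refine ⟨‖(ℜ t : T)‖, ?_⟩
  have hℜ : (ℜ (algebraMap ℝ T ‖(ℜ t : T)‖) : T) = algebraMap ℝ T ‖(ℜ t : T)‖ :=
    IsSelfAdjoint.coe_realPart (.algebraMap T (.all _))
  rw [mem_accretiveCone_iff, map_add, AddSubgroup.coe_add, hℜ]
  exact neg_le_iff_add_nonneg'.1 (ℜ t).2.neg_algebraMap_norm_le_self

theorem extendRCLike_nonneg {G : Module.Dual ℝ T} (hG : ∀ t ∈ accretiveCone T, 0 ≤ G t) {t : T}
    (ht : 0 ≤ t) : 0 ≤ (G.extendRCLike t : ℂ) := by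
  have hre : 0 ≤ G t :=
    hG t (by rwa [mem_accretiveCone_iff, (IsSelfAdjoint.of_nonneg ht).coe_realPart])
  have him : ∀ c : ℂ, c.re = 0 → 0 ≤ G (c • t) := fun c hc => hG _ <| by
    simp [mem_accretiveCone_iff, hc, (IsSelfAdjoint.of_nonneg ht).imaginaryPart, realPart_smul]
  have hI : G (Complex.I • t) = 0 := by
    refine le_antisymm ?_ (him Complex.I Complex.I_re)
    simpa using him (-Complex.I) (by simp)
  simpa [Module.Dual.extendRCLike_apply, hI] using hre

theorem exists_positive_extension {ρ : S →⋆ₐ[ℂ] T} (hρ : Function.Injective ρ)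
    (f : S →ₚ[ℂ] ℂ) : ∃ F : T →ₚ[ℂ] ℂ, ∀ s, F (ρ s) = f s := by
  obtain ⟨G, hGf, hG⟩ := exists_nonneg_extension (accretiveCone T)
    (i := ρ.toLinearMap.restrictScalars ℝ) hρ
    (Complex.reLm ∘ₗ f.toLinearMap.restrictScalars ℝ)
    (fun s hs => by
      have hρs : 0 ≤ ρ (ℜ s) := (map_realPart ρ s).symm ▸ hs
      have hfs : 0 ≤ f (ℜ s) :=
        map_nonneg f ((map_nonneg_iff_of_injective (ρ : S →⋆ₙₐ[ℂ] T) hρ).1 hρs)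
      rw [map_realPart f, Complex.coe_realPart] at hfs
      exact Complex.zero_le_real.1 hfs)
    (fun t => (exists_algebraMap_add_mem_accretiveCone t).imp' (algebraMap ℝ S) fun c hc => by
      convert hc
      simp [Algebra.algebraMap_eq_smul_one])
  let F := Module.Dual.extendRCLike (𝕜 := ℂ) G
  have hre : ∀ s, (F (ρ s)).re = (f s).re := fun s =>
    (Module.Dual.re_extendRCLike_apply (𝕜 := ℂ) G (ρ s)).trans (hGf s)
  refine ⟨.mk₀ F fun t => extendRCLike_nonneg hG, fun s => Complex.ext (hre s) ?_⟩
  have him : (F (ρ s)).im = (f s).im := by simpa using hre (-Complex.I • s)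
  exact him

end Krein

section Arveson

variable {S T : Type*} [CStarAlgebra S] [CStarAlgebra T]
variable {E : Type*} [NormedAddCommGroup E] [InnerProductSpace ℂ E]
variable {ι : Type*}

theorem cstarMatrix_sum_apply {κ : Type*} (s : Finset κ) (M : κ → CStarMatrix ι ι T) (i j : ι) :
    (∑ l ∈ s, M l) i j = ∑ l ∈ s, M l i j :=
  Matrix.sum_apply i j s M

variable [Fintype ι]

/-- The matrix `(⟪u, b i⟫ ⟪b j, v⟫ t)`, which pairs with the matrix coefficients of an operator in
the orthonormal basis `b` to give its coefficient at `u` and `v`. -/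
def coefficientMatrix (b : OrthonormalBasis ι ℂ E) (u v : E) (t : T) : CStarMatrix ι ι T :=
  .ofMatrix (.of fun i j => (⟪u, b i⟫_ℂ * ⟪b j, v⟫_ℂ) • t)

theorem coefficientMatrix_apply (b : OrthonormalBasis ι ℂ E) (u v : E) (t : T) (i j : ι) :
    coefficientMatrix b u v t i j = (⟪u, b i⟫_ℂ * ⟪b j, v⟫_ℂ) • t := rfl

theorem coefficientMatrix_eq_sum [DecidableEq ι] (b : OrthonormalBasis ι ℂ E) (u v : E) (t : T) :
    coefficientMatrix b u v t = ∑ i, ∑ j, (⟪u, b i⟫_ℂ * ⟪b j, v⟫_ℂ) •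
      CStarMatrix.ofMatrixₗ (R := ℂ) (Matrix.single i j t) := by
  simp only [← map_smul, ← map_sum, Matrix.smul_single]
  exact congrArg CStarMatrix.ofMatrix (Matrix.matrix_eq_sum_single _)

theorem inner_eq_sum_coefficients (b : OrthonormalBasis ι ℂ E) (R : E →L[ℂ] E) (u v : E) :
    ⟪u, R v⟫_ℂ = ∑ i, ∑ j, (⟪u, b i⟫_ℂ * ⟪b j, v⟫_ℂ) * ⟪b i, R (b j)⟫_ℂ := by
  conv_lhs => rw [← b.sum_inner_mul_inner, ← b.sum_repr' v]
  simp only [map_sum, map_smul, inner_sum, inner_smul_right, Finset.mul_sum, mul_assoc]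

/-- The linear map `T → B(E)` whose matrix coefficients in an orthonormal basis are given by a
functional on matrices over `T`; this inverts `matrixFunctional`, up to the choice of `b`. -/
def mapOfFunctional [DecidableEq ι] (b : OrthonormalBasis ι ℂ E)
    (F : CStarMatrix ι ι T →ₗ[ℂ] ℂ) : T →ₗ[ℂ] (E →L[ℂ] E) :=
  ∑ i, ∑ j, (F ∘ₗ CStarMatrix.ofMatrixₗ.toLinearMap ∘ₗ Matrix.singleLinearMap ℂ i j).smulRight
    (InnerProductSpace.rankOne ℂ (b i) (b j))

theorem inner_mapOfFunctional [DecidableEq ι] (b : OrthonormalBasis ι ℂ E)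
    (F : CStarMatrix ι ι T →ₗ[ℂ] ℂ) (t : T) (u v : E) :
    ⟪u, mapOfFunctional b F t v⟫_ℂ = F (coefficientMatrix b u v t) := by
  rw [coefficientMatrix_eq_sum]
  simp only [mapOfFunctional, map_sum, map_smul, sum_apply, LinearMap.sum_apply, inner_sum,
    LinearMap.smulRight_apply, smul_apply, inner_smul_right, InnerProductSpace.rankOne_apply,
    LinearMap.comp_apply, smul_eq_mul]
  refine Finset.sum_congr rfl fun i _ => Finset.sum_congr rfl fun j _ => ?_
  rw [mul_comm, mul_comm ⟪b j, v⟫_ℂ]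
  rfl

variable [CompleteSpace E] [PartialOrder S] [StarOrderedRing S]
variable [PartialOrder T] [StarOrderedRing T]

/-- The positive functional `M ↦ ∑ ⟪x i, φ (M i j) (x j)⟫` on matrices that a completely positive
map `φ` and a column of vectors `x` define. -/
def matrixFunctional (φ : S →CP (E →L[ℂ] E)) (x : ι → E) : CStarMatrix ι ι S →ₚ[ℂ] ℂ :=
  .mk₀
    { toFun M := ∑ i, ∑ j, ⟪x i, φ (M i j) (x j)⟫_ℂ
      map_add' M N := by simp [Finset.sum_add_distrib]
      map_smul' c M := by simp [Finset.mul_sum] }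
    fun _ hM => sum_inner_map_nonneg φ hM x

theorem matrixFunctional_apply (φ : S →CP (E →L[ℂ] E)) (x : ι → E) (M : CStarMatrix ι ι S) :
    matrixFunctional φ x M = ∑ i, ∑ j, ⟪x i, φ (M i j) (x j)⟫_ℂ := rfl

theorem exists_cp_of_functional (b : OrthonormalBasis ι ℂ E) (F : CStarMatrix ι ι T →ₚ[ℂ] ℂ) :
    ∃ Φ : T →CP (E →L[ℂ] E), ∀ t u v, ⟪u, Φ t v⟫_ℂ = F (coefficientMatrix b u v t) := by
  classical
  refine ⟨cpOfQuadraticForm (mapOfFunctional b F.toLinearMap) fun k a x => ?_,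
    inner_mapOfFunctional b F.toLinearMap⟩
  let r : ι → T := fun j => ∑ l, ⟪b j, x l⟫_ℂ • a l
  have hr : ∑ l, ∑ m, coefficientMatrix b (x l) (x m) (star (a l) * a m) = gramMatrix r := by
    ext i j
    simp [cstarMatrix_sum_apply, gramMatrix_apply, coefficientMatrix_apply, r,
      Finset.sum_mul_sum, mul_smul, smul_comm ⟪b j, _⟫_ℂ]
  simp only [inner_mapOfFunctional, PositiveLinearMap.coe_toLinearMap, ← map_sum, hr]
  exact map_nonneg F (gramMatrix_nonneg r)

theorem exists_cp_extension {ρ : S →⋆ₐ[ℂ] T} (hρ : Function.Injective ρ)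
    (b : OrthonormalBasis ι ℂ E) (φ : S →CP (E →L[ℂ] E)) :
    ∃ Φ : T →CP (E →L[ℂ] E), ∀ s, Φ (ρ s) = φ s := by
  classical
  let ρ' : CStarMatrix ι ι S →⋆ₐ[ℂ] CStarMatrix ι ι T :=
    { CStarMatrix.mapₙₐ (ρ : S →⋆ₙₐ[ℂ] T) with
      map_one' := by ext i j; by_cases h : i = j <;> simp [h, CStarMatrix.one_apply]
      commutes' c := by
        ext i j
        by_cases h : i = j <;> simp [h, CStarMatrix.algebraMap_apply, AlgHomClass.commutes] }
  obtain ⟨F, hF⟩ := exists_positive_extension (ρ := ρ') (CStarMatrix.map_injective hρ)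
    (matrixFunctional φ b)
  obtain ⟨Φ, hΦ⟩ := exists_cp_of_functional b F
  refine ⟨Φ, fun s => ?_⟩
  ext1 v
  refine ext_inner_left ℂ fun u => ?_
  have hM : coefficientMatrix b u v (ρ s) = ρ' (coefficientMatrix b u v s) := by
    ext i j
    exact (map_smul ρ _ s).symm
  rw [hΦ, hM, hF, matrixFunctional_apply, inner_eq_sum_coefficients b]
  simp only [coefficientMatrix_apply, map_smul, smul_apply, inner_smul_right]

end Arveson

section Stinespring

variable {S : Type*} [CStarAlgebra S]
variable {H : Type*} [NormedAddCommGroup H] [InnerProductSpace ℂ H]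

theorem exists_star_mul_self_add_eq [PartialOrder S] [StarOrderedRing S] (c : S) :
    ∃ r : S, star c * c + star r * r = (‖c‖ ^ 2 : ℝ) • (1 : S) := by
  have hle : star c * c ≤ algebraMap ℝ S (‖c‖ ^ 2) := CStarAlgebra.star_mul_le_algebraMap_norm_sq
  obtain ⟨r, hr⟩ := CStarAlgebra.nonneg_iff_eq_star_mul_self.1 (sub_nonneg.2 hle)
  exact ⟨r, by rw [← hr, add_sub_cancel, Algebra.algebraMap_eq_smul_one]⟩

/-- The operator-valued kernel `(a, b) ↦ ψ (a⋆ b)`, whose reproducing kernel Hilbert space is the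
dilation space of `ψ`. -/
def dilationKernel (ψ : S →ₗ[ℂ] (H →L[ℂ] H)) : Matrix S S (H →L[ℂ] H) :=
  .of fun a b => ψ (star a * b)

theorem dilationKernel_apply (ψ : S →ₗ[ℂ] (H →L[ℂ] H)) (a b : S) :
    dilationKernel ψ a b = ψ (star a * b) := rfl

variable [CompleteSpace H]

section Kernel

variable {X L : Type*} [NormedAddCommGroup L] [InnerProductSpace ℂ L] [CompleteSpace L]
  [RKHS ℂ L X H]

theorem ext_of_inner_kerFun {f g : L}
    (h : ∀ b w, ⟪RKHS.kerFun L b w, f⟫_ℂ = ⟪RKHS.kerFun L b w, g⟫_ℂ) : f = g :=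
  RKHS.ext fun b => ext_inner_left ℂ fun w => by
    rw [← RKHS.kerFun_inner, ← RKHS.kerFun_inner, h]

theorem ext_of_kerFun {T T' : L →L[ℂ] L}
    (h : ∀ b v, T (RKHS.kerFun L b v) = T' (RKHS.kerFun L b v)) : T = T' := by
  refine star_injective (ContinuousLinearMap.ext fun f => ext_of_inner_kerFun fun b w => ?_)
  rw [ContinuousLinearMap.star_eq_adjoint, ContinuousLinearMap.star_eq_adjoint,
    ContinuousLinearMap.adjoint_inner_right, ContinuousLinearMap.adjoint_inner_right, h]

end Kernel

variable {L : Type*} [NormedAddCommGroup L] [InnerProductSpace ℂ L] [CompleteSpace L]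
  [RKHS ℂ L S H]

variable (L) in
/-- The combination of kernel functions `∑ k (c b) (f b)`: left multiplication by `c` on the dense
subspace of the finite combinations `∑ k b (f b)`. -/
def shiftedCombination (c : S) : (S →₀ H) →ₗ[ℂ] L :=
  Finsupp.lsum ℂ fun b => (RKHS.kerFun L (c * b) : H →ₗ[ℂ] L)

theorem shiftedCombination_single (c b : S) (v : H) :
    shiftedCombination L c (Finsupp.single b v) = RKHS.kerFun L (c * b) v := by
  simp [shiftedCombination]

theorem denseRange_shiftedCombination_one :
    DenseRange (shiftedCombination L (1 : S) : (S →₀ H) → L) := by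
  have hdense := RKHS.kerFun_dense (𝕜 := ℂ) L
  rw [← Submodule.dense_iff_topologicalClosure_eq_top] at hdense
  refine hdense.mono (Submodule.span_le (p := LinearMap.range (shiftedCombination L 1)).2 ?_)
  rintro _ ⟨b, v, rfl⟩
  exact ⟨Finsupp.single b v, by rw [shiftedCombination_single, one_mul]⟩

variable {ψ : S →ₗ[ℂ] (H →L[ℂ] H)}

theorem inner_kerFun_kerFun (hL : RKHS.kernel L = dilationKernel ψ) (a b : S) (v w : H) :
    ⟪RKHS.kerFun L a v, RKHS.kerFun L b w⟫_ℂ = ⟪v, ψ (star a * b) w⟫_ℂ := by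
  rw [RKHS.kerFun_inner, RKHS.kerFun_apply, hL, dilationKernel_apply]

theorem inner_shiftedCombination (hL : RKHS.kernel L = dilationKernel ψ) (c : S) (f : S →₀ H) :
    ⟪shiftedCombination L c f, shiftedCombination L c f⟫_ℂ =
      f.sum fun a v => f.sum fun b w => ⟪v, ψ (star a * (star c * c) * b) w⟫_ℂ := by
  simp only [shiftedCombination, Finsupp.lsum_apply, Finsupp.sum, sum_inner, inner_sum,
    ContinuousLinearMap.coe_coe, inner_kerFun_kerFun hL, star_mul, mul_assoc]
  exact Finset.sum_comm

theorem adjoint_shift_apply {c : S} {T : L →L[ℂ] L}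
    (hT : ∀ b v, T (RKHS.kerFun L b v) = RKHS.kerFun L (c * b) v) (f : L) (a : S) :
    star T f a = f (c * a) := by
  refine ext_inner_left ℂ fun v => ?_
  rw [← RKHS.kerFun_inner, ContinuousLinearMap.star_eq_adjoint,
    ContinuousLinearMap.adjoint_inner_right, hT, RKHS.kerFun_inner]

theorem kerFun_add (hL : RKHS.kernel L = dilationKernel ψ) (a b : S) (v : H) :
    RKHS.kerFun L (a + b) v = RKHS.kerFun L a v + RKHS.kerFun L b v :=
  ext_of_inner_kerFun fun c w => by
    simp only [inner_add_right, inner_kerFun_kerFun hL, mul_add, map_add, add_apply]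

theorem kerFun_smul (hL : RKHS.kernel L = dilationKernel ψ) (z : ℂ) (a : S) (v : H) :
    RKHS.kerFun L (z • a) v = z • RKHS.kerFun L a v :=
  ext_of_inner_kerFun fun c w => by
    simp only [inner_smul_right, inner_kerFun_kerFun hL, mul_smul_comm, map_smul, smul_apply]

theorem compress_kerFun_one {π : S →⋆ₐ[ℂ] (L →L[ℂ] L)} (hL : RKHS.kernel L = dilationKernel ψ)
    (hπ : ∀ c b v, π c (RKHS.kerFun L b v) = RKHS.kerFun L (c * b) v) (a : S) :
    compress (RKHS.kerFun L (1 : S)) (π a) = ψ a := by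
  ext1 y
  refine ext_inner_left ℂ fun x => ?_
  rw [inner_compress, hπ, inner_kerFun_kerFun hL, star_one, one_mul, mul_one]

variable [PartialOrder S] [StarOrderedRing S]

/-- The squared norms of the `c`- and the `r`-combination add up, where `c⋆c + r⋆r = ‖c‖²`. -/
theorem norm_shiftedCombination_le (hL : RKHS.kernel L = dilationKernel ψ) (c : S) (f : S →₀ H) :
    ‖shiftedCombination L c f‖ ≤ ‖c‖ * ‖shiftedCombination L 1 f‖ := by
  obtain ⟨r, hr⟩ := exists_star_mul_self_add_eq c
  have hinner : ⟪shiftedCombination L c f, shiftedCombination L c f⟫_ℂ +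
        ⟪shiftedCombination L r f, shiftedCombination L r f⟫_ℂ =
      ((‖c‖ ^ 2 : ℝ) : ℂ) * ⟪shiftedCombination L 1 f, shiftedCombination L 1 f⟫_ℂ := by
    simp only [inner_shiftedCombination hL, Finsupp.sum, Finset.mul_sum, ← Finset.sum_add_distrib,
      ← inner_add_right, ← add_apply, ← map_add, ← add_mul, ← mul_add, hr]
    simp [← Complex.coe_smul, inner_smul_right]
  have hnorm : ‖shiftedCombination L c f‖ ^ 2 + ‖shiftedCombination L r f‖ ^ 2 =
      (‖c‖ * ‖shiftedCombination L 1 f‖) ^ 2 := by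
    simp only [inner_self_eq_norm_sq_to_K, Complex.coe_algebraMap] at hinner
    rw [mul_pow]
    exact_mod_cast hinner
  exact le_of_sq_le_sq (by linarith [sq_nonneg ‖shiftedCombination L r f‖]) (by positivity)

theorem exists_shift (hL : RKHS.kernel L = dilationKernel ψ) (c : S) :
    ∃ T : L →L[ℂ] L, ∀ b v, T (RKHS.kerFun L b v) = RKHS.kerFun L (c * b) v := by
  refine ⟨(shiftedCombination L c).extendOfNorm (shiftedCombination L 1), fun b v => ?_⟩
  have h := (shiftedCombination L c).extendOfNorm_eq denseRange_shiftedCombination_one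
    ⟨‖c‖, norm_shiftedCombination_le hL c⟩ (Finsupp.single b v)
  simpa only [shiftedCombination_single, one_mul] using h

theorem exists_shift_representation (hL : RKHS.kernel L = dilationKernel ψ) :
    ∃ π : S →⋆ₐ[ℂ] (L →L[ℂ] L), ∀ c b v, π c (RKHS.kerFun L b v) = RKHS.kerFun L (c * b) v := by
  choose T hT using exists_shift (L := L) hL
  have hone : T 1 = 1 := ext_of_kerFun fun b v => by rw [hT, one_mul, one_apply_eq_self]
  have hsmul : ∀ (z : ℂ) (a : S), T (z • a) = z • T a := fun z a =>
    ext_of_kerFun fun b v => by rw [hT, smul_apply, hT, smul_mul_assoc, kerFun_smul hL]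
  refine ⟨
    { toFun := T
      map_one' := hone
      map_mul' a b := ext_of_kerFun fun c v => by rw [mul_apply_eq_comp, hT, hT, hT, mul_assoc]
      map_zero' := by simpa using hsmul 0 0
      map_add' a b := ext_of_kerFun fun c v => by
        rw [add_apply, hT, hT, hT, add_mul, kerFun_add hL]
      commutes' z := by
        rw [Algebra.algebraMap_eq_smul_one, Algebra.algebraMap_eq_smul_one, hsmul, hone]
      map_star' a := ext_of_kerFun fun c v => RKHS.ext fun b => by
        rw [hT, adjoint_shift_apply (hT a), RKHS.kerFun_apply, RKHS.kerFun_apply, hL]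
        simp only [dilationKernel_apply, star_mul, mul_assoc] }, hT⟩

theorem posSemidef_dilationKernel (ψ : S →CP (H →L[ℂ] H)) :
    (dilationKernel ψ.toLinearMap).PosSemidef := by
  apply (RKHS.posSemidef_tfae.out 0 2).2
  refine ⟨?_, fun v => ?_⟩
  · ext1 a b
    rw [Matrix.conjTranspose_apply, dilationKernel_apply, dilationKernel_apply]
    exact (map_star ψ _).symm.trans (congrArg ψ (by simp))
  · have hnonneg := sum_inner_map_star_mul_nonneg ψ (fun a : v.support => (a : S)) fun a => v a
    have hconj : (v.sum fun b w => v.sum fun a u => ⟪dilationKernel ψ.toLinearMap a b w, u⟫_ℂ) =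
        conj (∑ a : v.support, ∑ b : v.support, ⟪v a, ψ (star (a : S) * b) (v b)⟫_ℂ) := by
      simp only [map_sum, inner_conj_symm]
      rw [Finset.sum_comm]
      simp only [Finsupp.sum, ← Finset.sum_coe_sort v.support]
      rfl
    rw [hconj]
    exact (Complex.nonneg_iff.1 hnonneg).1

end Stinespring

universe v w

section Dilation

variable {S : Type v} [CStarAlgebra S] [PartialOrder S] [StarOrderedRing S]
variable {H : Type w} [NormedAddCommGroup H] [InnerProductSpace ℂ H] [CompleteSpace H]

theorem exists_stinespring_dilation (ψ : S →CP (H →L[ℂ] H)) :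
    ∃ (L : Type (max v w)) (_ : NormedAddCommGroup L) (_ : InnerProductSpace ℂ L)
      (_ : CompleteSpace L) (π : S →⋆ₐ[ℂ] (L →L[ℂ] L)) (V : H →L[ℂ] L),
      ∀ a, compress V (π a) = ψ a := by
  have : Fact (dilationKernel ψ.toLinearMap).PosSemidef := ⟨posSemidef_dilationKernel ψ⟩
  let L := RKHS.OfKernel (dilationKernel ψ.toLinearMap)
  have hL : RKHS.kernel L = dilationKernel ψ.toLinearMap := RKHS.OfKernel.kernel_ofKernel
  obtain ⟨π, hπ⟩ := exists_shift_representation hL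
  have hcompress := compress_kerFun_one hL hπ
  exact ⟨L, inferInstance, inferInstance, inferInstance, π, RKHS.kerFun L 1, hcompress⟩

theorem exists_isometric_stinespring_dilation (ψ : S →CP (H →L[ℂ] H)) (hψ : ψ 1 = 1) :
    ∃ (L : Type (max v w)) (_ : NormedAddCommGroup L) (_ : InnerProductSpace ℂ L)
      (_ : CompleteSpace L) (π : S →⋆ₐ[ℂ] (L →L[ℂ] L)) (V : H →ₗᵢ[ℂ] L),
      ∀ a, compress V.toContinuousLinearMap (π a) = ψ a := by
  obtain ⟨L, _, _, _, π, V, hV⟩ := exists_stinespring_dilation ψ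
  refine ⟨L, _, _, inferInstance, π, V.toLinearMap.isometryOfInner fun x y => ?_, hV⟩
  have hinner := inner_compress V (π 1) x y
  rw [hV, hψ, map_one] at hinner
  exact hinner.symm

theorem norm_map_le_of_map_one (ψ : S →CP (H →L[ℂ] H)) (hψ : ψ 1 = 1) (a : S) : ‖ψ a‖ ≤ ‖a‖ := by
  obtain ⟨L, _, _, _, π, V, hV⟩ := exists_isometric_stinespring_dilation ψ hψ
  rw [← hV]
  exact (norm_compress_le V.norm_toContinuousLinearMap_le _).trans
    (NonUnitalStarAlgHom.norm_apply_le π a)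

end Dilation

section DirectSum

variable {S : Type*} [Ring S] [StarRing S] [Algebra ℂ S]
variable {H : Type*} [NormedAddCommGroup H] [InnerProductSpace ℂ H]
variable {K : Type*} [NormedAddCommGroup K] [InnerProductSpace ℂ K]

/-- The operator `T ⊕ T'` on the Hilbert space direct sum. -/
def diagonalOperator (T : H →L[ℂ] H) (T' : K →L[ℂ] K) :
    WithLp 2 (H × K) →L[ℂ] WithLp 2 (H × K) :=
  (WithLp.prodContinuousLinearEquiv 2 ℂ H K).symm.toContinuousLinearMap ∘L
    (T.prodMap T') ∘L (WithLp.prodContinuousLinearEquiv 2 ℂ H K).toContinuousLinearMap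

theorem diagonalOperator_apply (T : H →L[ℂ] H) (T' : K →L[ℂ] K) (z : WithLp 2 (H × K)) :
    diagonalOperator T T' z = WithLp.toLp 2 (T z.fst, T' z.snd) := rfl

variable (H K) in
/-- The isometric embedding of the first summand into `H ⊕ K`. -/
def firstEmbedding : H →ₗᵢ[ℂ] WithLp 2 (H × K) where
  toLinearMap := (WithLp.linearEquiv 2 ℂ (H × K)).symm.toLinearMap ∘ₗ LinearMap.inl ℂ H K
  norm_map' x := by simp

theorem firstEmbedding_apply (x : H) : firstEmbedding H K x = WithLp.toLp 2 (x, 0) := rfl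

variable [CompleteSpace H] [CompleteSpace K]

/-- The direct sum of two representations. -/
def directSum (π : S →⋆ₐ[ℂ] (H →L[ℂ] H)) (σ : S →⋆ₐ[ℂ] (K →L[ℂ] K)) :
    S →⋆ₐ[ℂ] (WithLp 2 (H × K) →L[ℂ] WithLp 2 (H × K)) where
  toFun a := diagonalOperator (π a) (σ a)
  map_one' := by rw [map_one, map_one]; rfl
  map_mul' _ _ := by rw [map_mul, map_mul]; rfl
  map_zero' := by rw [map_zero, map_zero]; rfl
  map_add' _ _ := by rw [map_add, map_add]; rfl
  commutes' c := by rw [AlgHomClass.commutes, AlgHomClass.commutes]; rfl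
  map_star' a := by
    ext1 z
    refine ext_inner_left ℂ fun w => ?_
    simp only [map_star, ContinuousLinearMap.star_eq_adjoint,
      ContinuousLinearMap.adjoint_inner_right, WithLp.prod_inner_apply, diagonalOperator_apply]
    rfl

theorem directSum_apply (π : S →⋆ₐ[ℂ] (H →L[ℂ] H)) (σ : S →⋆ₐ[ℂ] (K →L[ℂ] K)) (a : S)
    (z : WithLp 2 (H × K)) : directSum π σ a z = WithLp.toLp 2 (π a z.fst, σ a z.snd) := rfl

theorem directSum_injective (π : S →⋆ₐ[ℂ] (H →L[ℂ] H)) {σ : S →⋆ₐ[ℂ] (K →L[ℂ] K)}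
    (hσ : Function.Injective σ) : Function.Injective (directSum π σ) := fun _ _ h =>
  hσ <| ContinuousLinearMap.ext fun y => congr(($h (WithLp.toLp 2 (0, y))).snd)

theorem compress_directSum (π : S →⋆ₐ[ℂ] (H →L[ℂ] H)) (σ : S →⋆ₐ[ℂ] (K →L[ℂ] K)) (a : S) :
    compress (firstEmbedding H K).toContinuousLinearMap (directSum π σ a) = π a := by
  ext1 y
  refine ext_inner_left ℂ fun x => ?_
  rw [inner_compress]
  simp [firstEmbedding_apply, directSum_apply, WithLp.prod_inner_apply]

end DirectSum

section Equivalence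

variable {d : ℕ}
variable {H : Type u} [NormedAddCommGroup H] [InnerProductSpace ℂ H] [CompleteSpace H]
variable {K : Type u} [NormedAddCommGroup K] [InnerProductSpace ℂ K] [CompleteSpace K]

theorem mem_of_gen_mem {A : Fin d → H →L[ℂ] H} {T : StarSubalgebra ℂ (cstar A)}
    (hT : IsClosed (T : Set (cstar A))) (h : ∀ i, gen A i ∈ T) (s : cstar A) : s ∈ T := by
  have hclosed : IsClosed ((T.map (cstar A).subtype : StarSubalgebra ℂ (H →L[ℂ] H)) :
      Set (H →L[ℂ] H)) := by
    rw [StarSubalgebra.coe_map]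
    exact (isClosed_cstar A).isClosedEmbedding_subtypeVal.isClosedMap _ hT
  have hle : cstar A ≤ T.map (cstar A).subtype := by
    refine StarSubalgebra.topologicalClosure_minimal (StarAlgebra.adjoin_le ?_) hclosed
    rintro _ ⟨i, rfl⟩
    exact ⟨gen A i, h i, rfl⟩
  obtain ⟨t, ht, hts⟩ := hle s.2
  rwa [← Subtype.ext (a1 := t) (a2 := s) hts]

theorem range_eq_cstar {A : Fin d → H →L[ℂ] H} {ρ : cstar A →⋆ₐ[ℂ] (K →L[ℂ] K)}
    (hρ : Function.Injective ρ) : ρ.range = cstar fun i => ρ (gen A i) := by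
  have hiso : Isometry ρ := NonUnitalStarAlgHom.isometry ρ hρ
  refine le_antisymm ?_ (StarSubalgebra.topologicalClosure_minimal (StarAlgebra.adjoin_le ?_)
    hiso.isClosedEmbedding.isClosed_range)
  · rintro _ ⟨s, rfl⟩
    exact mem_of_gen_mem (T := (cstar fun i => ρ (gen A i)).comap ρ)
      ((isClosed_cstar _).preimage hiso.continuous)
      (fun i => (gen (fun i => ρ (gen A i)) i).2) s
  · rintro _ ⟨i, rfl⟩
    exact ⟨gen A i, rfl⟩

theorem equivalent_of_injective {A : Fin d → H →L[ℂ] H} {ρ : cstar A →⋆ₐ[ℂ] (K →L[ℂ] K)}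
    (hρ : Function.Injective ρ) : Equivalent A fun i => ρ (gen A i) := by
  have hmem (s : cstar A) : ρ s ∈ cstar fun i => ρ (gen A i) := range_eq_cstar hρ ▸ ⟨s, rfl⟩
  refine ⟨StarAlgEquiv.ofBijective (ρ.codRestrict _ hmem)
    ⟨(StarAlgHom.injective_codRestrict ρ _ hmem).2 hρ, ?_⟩, fun _ => rfl⟩
  rintro ⟨b, hb⟩
  rw [← range_eq_cstar hρ] at hb
  obtain ⟨s, rfl⟩ := hb
  exact ⟨s, rfl⟩

theorem Equivalent.exists_faithful_representation {A : Fin d → H →L[ℂ] H}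
    {B : Fin d → K →L[ℂ] K} (h : Equivalent A B) :
    ∃ ρ : cstar A →⋆ₐ[ℂ] (K →L[ℂ] K), Function.Injective ρ ∧ ∀ i, ρ (gen A i) = B i := by
  obtain ⟨φ, hφ⟩ := h
  exact ⟨(cstar B).subtype.comp (φ : cstar A →⋆ₐ[ℂ] cstar B),
    Subtype.val_injective.comp φ.injective, fun i => congrArg Subtype.val (hφ i)⟩

theorem Equivalent.refl (A : Fin d → H →L[ℂ] H) : Equivalent A A :=
  ⟨StarAlgEquiv.refl ℂ _, fun _ => rfl⟩

end Equivalence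

section UCPImage

variable {d : ℕ}
variable {H : Type u} [NormedAddCommGroup H] [InnerProductSpace ℂ H] [CompleteSpace H]
variable {K : Type u} [NormedAddCommGroup K] [InnerProductSpace ℂ K] [CompleteSpace K]
variable {E : Type*} [NormedAddCommGroup E] [InnerProductSpace ℂ E] [CompleteSpace E]
variable {A : Fin d → H →L[ℂ] H} {B : Fin d → K →L[ℂ] K}

/-- The tuple `X` is the image of `A` under a unital completely positive map on `C*(A)`. For
`E = ℂⁿ` this says that `X` lies in the `n`-th level of the matrix range of `A`. -/
def IsUCPImage (A : Fin d → H →L[ℂ] H) (X : Fin d → E →L[ℂ] E) : Prop :=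
  ∃ φ : cstar A →CP (E →L[ℂ] E), φ 1 = 1 ∧ ∀ i, φ (gen A i) = X i

theorem Equivalent.isUCPImage_map (h : Equivalent A B) {Φ : (K →L[ℂ] K) →CP (E →L[ℂ] E)}
    (hΦ : Φ 1 = 1) : IsUCPImage A fun i => Φ (B i) := by
  obtain ⟨ρ, -, hB⟩ := h.exists_faithful_representation
  exact ⟨cpComp Φ (cpOfHom ρ), (congrArg Φ (map_one ρ)).trans hΦ,
    fun i => congrArg Φ (hB i)⟩

theorem Equivalent.exists_ucp_extension (h : Equivalent A B) {n : ℕ} {X : Fin d → Mat n}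
    (hX : X ∈ matrixRange n A) :
    ∃ Φ : (K →L[ℂ] K) →CP Mat n, Φ 1 = 1 ∧ ∀ i, Φ (B i) = X i := by
  obtain ⟨ρ, hρ, hB⟩ := h.exists_faithful_representation
  obtain ⟨φ, hφ, hφX⟩ := hX
  obtain ⟨Φ, hΦ⟩ := exists_cp_extension hρ (EuclideanSpace.basisFun (Fin n) ℂ) φ
  refine ⟨Φ, ?_, fun i => ?_⟩
  · rw [← map_one ρ, hΦ, hφ]
  · rw [← hB, hΦ, hφX]

theorem DilatesTo.matrixRange_subset (h : DilatesTo A B) (n : ℕ) :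
    matrixRange n A ⊆ matrixRange n B := by
  obtain ⟨L, _, _, _, M, _, U, V, hAU, hBV, hUV⟩ := h
  intro X hX
  obtain ⟨Φ, hΦ, hΦX⟩ := hAU.exists_ucp_extension hX
  let J := M.subtypeₗᵢ.toContinuousLinearMap
  have hU (i : Fin d) : compress J (V i) = U i := by
    ext1 y
    refine ext_inner_left ℂ fun x => ?_
    rw [inner_compress, hUV]
    exact (Submodule.inner_orthogonalProjectionOnto_eq_of_mem_left x _).symm
  have hΦJ : cpComp Φ (compress J) 1 = 1 := by
    rw [cpComp_apply, compress_one, hΦ]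
  have hX' : X = fun i => cpComp Φ (compress J) (V i) := by
    ext1 i
    rw [cpComp_apply, hU, hΦX]
  exact hX' ▸ hBV.isUCPImage_map hΦJ

theorem dilatesTo_compress {L : Type u} [NormedAddCommGroup L] [InnerProductSpace ℂ L]
    [CompleteSpace L] {V : Fin d → L →L[ℂ] L} (hBV : Equivalent B V) (W : H →ₗᵢ[ℂ] L) :
    DilatesTo (fun i => compress W.toContinuousLinearMap (V i)) B := by
  let M : Submodule ℂ L := LinearMap.range W.toLinearMap
  let e : H ≃ₗᵢ[ℂ] M := W.equivRange
  have hM : CompleteSpace M := e.toIsometryEquiv.completeSpace_iff.1 inferInstance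
  let ρ : cstar (fun i => compress W.toContinuousLinearMap (V i)) →⋆ₐ[ℂ] (M →L[ℂ] M) :=
    (e.conjStarAlgEquiv : (H →L[ℂ] H) →⋆ₐ[ℂ] (M →L[ℂ] M)).comp (cstar _).subtype
  have hρ : Function.Injective ρ := e.conjStarAlgEquiv.injective.comp Subtype.val_injective
  refine ⟨L, _, _, inferInstance, M, hM, fun i => ρ (gen _ i), V, equivalent_of_injective hρ,
    hBV, fun i => ?_⟩
  ext1 y
  obtain ⟨y, rfl⟩ := e.surjective y
  refine ext_inner_left ℂ fun x => ?_
  obtain ⟨x, rfl⟩ := e.surjective x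
  calc ⟪e x, e (compress W.toContinuousLinearMap (V i) (e.symm (e y)))⟫_ℂ
      = ⟪W x, V i (W y)⟫_ℂ := by
        rw [e.symm_apply_apply, e.inner_map_map, inner_compress]
        rfl
    _ = ⟪e x, M.orthogonalProjectionOnto (V i (W y))⟫_ℂ :=
        (Submodule.inner_orthogonalProjectionOnto_eq_of_mem_left (e x) _).symm

/-- Adding the identity representation makes the Stinespring representation faithful. -/
theorem IsUCPImage.dilatesTo {X : Fin d → H →L[ℂ] H} (h : IsUCPImage B X) : DilatesTo X B := by
  obtain ⟨ψ, hψ, hψX⟩ := h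
  obtain ⟨L, _, _, _, π, V, hV⟩ := exists_isometric_stinespring_dilation ψ hψ
  have hB : Equivalent B fun i => directSum π (cstar B).subtype (gen B i) :=
    equivalent_of_injective (directSum_injective π Subtype.val_injective)
  have hX : X = fun i => compress ((firstEmbedding L K).comp V).toContinuousLinearMap
      (directSum π (cstar B).subtype (gen B i)) := by
    ext i y
    refine ext_inner_left ℂ fun x => ?_
    rw [inner_compress, ← hψX, ← hV, inner_compress, ← compress_directSum π (cstar B).subtype,
      inner_compress]
    rfl
  exact hX ▸ dilatesTo_compress hB _

end UCPImage

section LowerBound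

variable {d : ℕ}
variable {H : Type u} [NormedAddCommGroup H] [InnerProductSpace ℂ H] [CompleteSpace H]
variable {K : Type u} [NormedAddCommGroup K] [InnerProductSpace ℂ K] [CompleteSpace K]

theorem dmrTo_le_drDTo (A : Fin d → H →L[ℂ] H) (B : Fin d → K →L[ℂ] K) :
    dmrTo A B ≤ drDTo A B := by
  refine le_sInf ?_
  rintro _ ⟨L, _, _, _, A', C, hA, hC, rfl⟩
  refine iSup₂_le fun n _ => iSup₂_le fun X hX => ?_
  obtain ⟨Φ, hΦ, hΦX⟩ := hA.exists_ucp_extension hX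
  have hmem : (fun i => Φ (C i)) ∈ matrixRange n B :=
    hC.matrixRange_subset n ((Equivalent.refl C).isUCPImage_map hΦ)
  refine (iInf₂_le _ hmem).trans ?_
  rw [enorm_le_iff_norm_le, pi_norm_le_iff_of_nonneg (norm_nonneg _)]
  intro i
  rw [Pi.sub_apply, ← hΦX, ← map_sub]
  exact (norm_map_le_of_map_one Φ hΦ _).trans (norm_le_pi_norm (A' - C) i)

end LowerBound

section Limits

open Filter Topology

variable {H : Type*} [NormedAddCommGroup H] [InnerProductSpace ℂ H] [CompleteSpace H]
variable {ι : Type*}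

theorem exists_tendsto_of_norm_le (U : Ultrafilter ι) {f : ι → ℂ} {C : ℝ} (hf : ∀ j, ‖f j‖ ≤ C) :
    ∃ l : ℂ, ‖l‖ ≤ C ∧ Tendsto f U (𝓝 l) := by
  obtain ⟨l, hl, hUl⟩ := (isCompact_closedBall (0 : ℂ) C).ultrafilter_le_nhds (U.map f) <|
    le_principal_iff.2 <| Filter.mem_map.2 <| univ_mem' fun j =>
      mem_closedBall_zero_iff.2 (hf j)
  exact ⟨l, mem_closedBall_zero_iff.1 hl, hUl⟩

theorem exists_tendsto_inner (U : Ultrafilter ι) (T : ι → H →L[ℂ] H) {C : ℝ}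
    (hT : ∀ j, ‖T j‖ ≤ C) :
    ∃ T₀ : H →L[ℂ] H, ∀ x y, Tendsto (fun j => ⟪x, T j y⟫_ℂ) U (𝓝 ⟪x, T₀ y⟫_ℂ) := by
  have hbound (x y : H) (j : ι) : ‖⟪T j x, y⟫_ℂ‖ ≤ C * ‖x‖ * ‖y‖ :=
    (norm_inner_le_norm _ _).trans <| by
      gcongr
      exact (T j).le_of_opNorm_le (hT j) x
  choose l hl hlT using fun x y => exists_tendsto_of_norm_le U (hbound x y)
  let f : H →ₗ⋆[ℂ] H →ₗ[ℂ] ℂ := LinearMap.mk₂'ₛₗ (starRingEnd ℂ) (RingHom.id ℂ) l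
    (fun x x' y => tendsto_nhds_unique (hlT _ _) <| by
      simpa only [map_add, inner_add_left] using (hlT x y).add (hlT x' y))
    (fun c x y => tendsto_nhds_unique (hlT _ _) <| by
      simpa only [map_smul, inner_smul_left, smul_eq_mul] using (hlT x y).const_mul (conj c))
    (fun x y y' => tendsto_nhds_unique (hlT _ _) <| by
      simpa only [inner_add_right] using (hlT x y).add (hlT x y'))
    (fun c x y => tendsto_nhds_unique (hlT _ _) <| by
      simpa only [inner_smul_right, RingHom.id_apply, smul_eq_mul] using (hlT x y).const_mul c)
  let T₀ := InnerProductSpace.continuousLinearMapOfBilin (f.mkContinuous₂ C hl)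
  have hT₀ (x y : H) : ⟪T₀ y, x⟫_ℂ = l y x :=
    InnerProductSpace.continuousLinearMapOfBilin_apply (f.mkContinuous₂ C hl) y x
  refine ⟨T₀, fun x y => ?_⟩
  simpa only [Function.comp_def, inner_conj_symm, ← hT₀] using
    (Complex.continuous_conj.tendsto _).comp (hlT y x)

theorem exists_cp_limit {S : Type*} [NonUnitalCStarAlgebra S] [PartialOrder S] [StarOrderedRing S]
    (U : Ultrafilter ι) (ψ : ι → S →CP (H →L[ℂ] H)) (hψ : ∀ j a, ‖ψ j a‖ ≤ ‖a‖) :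
    ∃ ψ₀ : S →CP (H →L[ℂ] H),
      ∀ a x y, Tendsto (fun j => ⟪x, ψ j a y⟫_ℂ) U (𝓝 ⟪x, ψ₀ a y⟫_ℂ) := by
  choose T hT using fun a => exists_tendsto_inner U (fun j => ψ j a) (fun j => hψ j a)
  have ext_inner {T₁ T₂ : H →L[ℂ] H} (h : ∀ x y, ⟪x, T₁ y⟫_ℂ = ⟪x, T₂ y⟫_ℂ) : T₁ = T₂ :=
    ContinuousLinearMap.ext fun y => ext_inner_left ℂ fun x => h x y
  let T₀ : S →ₗ[ℂ] (H →L[ℂ] H) :=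
    { toFun := T
      map_add' a b := ext_inner fun x y => tendsto_nhds_unique (hT _ x y) <| by
        simpa only [map_add, add_apply, inner_add_right] using (hT a x y).add (hT b x y)
      map_smul' c a := ext_inner fun x y => tendsto_nhds_unique (hT _ x y) <| by
        simpa only [map_smul, smul_apply, inner_smul_right, RingHom.id_apply] using
          (hT a x y).const_mul c }
  refine ⟨cpOfQuadraticForm T₀ fun k a x => ?_, hT⟩
  exact ge_of_tendsto' (tendsto_finsetSum _ fun i _ => tendsto_finsetSum _ fun j _ =>
    hT (star (a i) * a j) (x i) (x j)) fun F => sum_inner_map_star_mul_nonneg (ψ F) a x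

end Limits

section UpperBound

open Filter Topology

variable {d : ℕ}
variable {H : Type u} [NormedAddCommGroup H] [InnerProductSpace ℂ H] [CompleteSpace H]
variable {K : Type u} [NormedAddCommGroup K] [InnerProductSpace ℂ K] [CompleteSpace K]
variable {A : Fin d → H →L[ℂ] H} {B : Fin d → K →L[ℂ] K} {t : NNReal}

theorem compress_mem_matrixRange (A : Fin d → H →L[ℂ] H) {n : ℕ}
    (J : EuclideanSpace ℂ (Fin n) →ₗᵢ[ℂ] H) :
    (fun i => compress J.toContinuousLinearMap (A i)) ∈ matrixRange n A :=
  (Equivalent.refl A).isUCPImage_map (compress_one J)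

theorem exists_mem_matrixRange_norm_sub_le (ht : dmrTo A B < t) {n : ℕ} {X : Fin d → Mat n}
    (hX : X ∈ matrixRange n A) : ∃ Y ∈ matrixRange n B, ‖X - Y‖ ≤ t := by
  -- The distance does not see level `0`, where all tuples coincide.
  rcases Nat.eq_zero_or_pos n with rfl | hn
  · let J : EuclideanSpace ℂ (Fin 0) →ₗᵢ[ℂ] K := ⟨0, fun x => by simp [Subsingleton.elim x 0]⟩
    refine ⟨_, compress_mem_matrixRange B J, ?_⟩
    rw [Subsingleton.elim (X - _) 0, norm_zero]
    exact t.2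
  have hlt : ⨅ Y ∈ matrixRange n B, ‖X - Y‖ₑ < t := by
    refine lt_of_le_of_lt ?_ ht
    exact le_iSup₂_of_le (f := fun n (_ : 1 ≤ n) => ⨆ X ∈ matrixRange n A,
      ⨅ Y ∈ matrixRange n B, ‖X - Y‖ₑ) n hn (le_iSup₂_of_le X hX le_rfl)
  simp only [iInf_lt_iff] at hlt
  obtain ⟨Y, hY, hXY⟩ := hlt
  exact ⟨Y, hY, by exact_mod_cast hXY.le⟩

/-- The compression of `A` to a finite-dimensional subspace belongs to the matrix range of `A`, and
a nearby tuple in the matrix range of `B` is transported back to `H`. -/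
theorem exists_cp_approximation (ht : dmrTo A B < t) (F : Finset H) :
    ∃ ψ : cstar B →CP (H →L[ℂ] H), (∀ b, ‖ψ b‖ ≤ ‖b‖) ∧ ∀ x ∈ F, ∀ y ∈ F,
      ⟪x, ψ 1 y⟫_ℂ = ⟪x, y⟫_ℂ ∧
        ∀ i, ‖⟪x, (A i - ψ (gen B i)) y⟫_ℂ‖ ≤ t * ‖x‖ * ‖y‖ := by
  let W : Submodule ℂ H := Submodule.span ℂ (F : Set H)
  have : FiniteDimensional ℂ W := FiniteDimensional.span_finset ℂ F
  let e := (stdOrthonormalBasis ℂ W).repr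
  let V : EuclideanSpace ℂ (Fin (Module.finrank ℂ W)) →ₗᵢ[ℂ] H :=
    W.subtypeₗᵢ.comp e.symm.toLinearIsometry
  let J := V.toContinuousLinearMap
  have hVF (x) (hx : x ∈ F) : ∃ u, V u = x :=
    ⟨e ⟨x, Submodule.subset_span hx⟩, by simp [V]⟩
  have hJ (u) : J.adjoint (V u) = u := congr($(compress_one V) u)
  obtain ⟨Y, ⟨φ, hφ, hφY⟩, hXY⟩ := exists_mem_matrixRange_norm_sub_le ht
    (compress_mem_matrixRange A V)
  refine ⟨cpComp (compress J.adjoint) φ, fun b => ?_, fun x hx y hy => ?_⟩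
  · have hJ_norm : ‖J.adjoint‖ ≤ 1 := by
      rw [LinearIsometryEquiv.norm_map]
      exact V.norm_toContinuousLinearMap_le
    exact (norm_compress_le hJ_norm _).trans (norm_map_le_of_map_one φ hφ b)
  · obtain ⟨u, rfl⟩ := hVF x hx
    obtain ⟨w, rfl⟩ := hVF y hy
    simp only [cpComp_apply, sub_apply, inner_sub_right, inner_compress, hJ]
    refine ⟨?_, fun i => ?_⟩
    · rw [hφ, one_apply_eq_self, V.inner_map_map]
    · calc ‖⟪V u, A i (V w)⟫_ℂ - ⟪u, φ (gen B i) w⟫_ℂ‖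
          = ‖⟪u, (compress J (A i) - Y i) w⟫_ℂ‖ := by
            rw [sub_apply, inner_sub_right, inner_compress, hφY]
            rfl
        _ ≤ ‖u‖ * ‖(compress J (A i) - Y i) w‖ := norm_inner_le_norm _ _
        _ ≤ ‖u‖ * (t * ‖w‖) := by
            gcongr
            exact ContinuousLinearMap.le_of_opNorm_le _ ((norm_le_pi_norm _ i).trans hXY) w
        _ = t * ‖V u‖ * ‖V w‖ := by
            rw [V.norm_map, V.norm_map]
            ring

theorem exists_isUCPImage_norm_sub_le (ht : dmrTo A B < t) :
    ∃ X : Fin d → H →L[ℂ] H, IsUCPImage B X ∧ ‖A - X‖ ≤ t := by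
  classical
  choose ψ hψ hψF using exists_cp_approximation ht
  let U : Ultrafilter (Finset H) := Ultrafilter.of atTop
  obtain ⟨ψ₀, hlim⟩ := exists_cp_limit U ψ hψ
  have hmem (x y : H) : ∀ᶠ F : Finset H in U, x ∈ F ∧ y ∈ F :=
    Eventually.filter_mono (Ultrafilter.of_le atTop) <|
      (eventually_ge_atTop ({x, y} : Finset H)).mono fun F hF => ⟨hF (by simp), hF (by simp)⟩
  have hψ₀ : ψ₀ 1 = 1 := by
    ext1 y
    refine ext_inner_left ℂ fun x => tendsto_nhds_unique (hlim 1 x y) ?_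
    exact tendsto_const_nhds.congr' <| (hmem x y).mono fun F ⟨hx, hy⟩ =>
      (hψF F x hx y hy).1.symm
  refine ⟨fun i => ψ₀ (gen B i), ⟨ψ₀, hψ₀, fun _ => rfl⟩,
    (pi_norm_le_iff_of_nonneg t.2).2 fun i =>
      ContinuousLinearMap.opNorm_le_of_re_inner_le t.2 fun x y hx hy => ?_⟩
  have hlim_sub : Tendsto (fun F => ⟪y, (A i - ψ F (gen B i)) x⟫_ℂ) U
      (𝓝 ⟪y, (A i - ψ₀ (gen B i)) x⟫_ℂ) := by
    simpa only [sub_apply, inner_sub_right] using tendsto_const_nhds.sub (hlim (gen B i) y x)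
  have hle : ‖⟪y, (A i - ψ₀ (gen B i)) x⟫_ℂ‖ ≤ t * ‖y‖ * ‖x‖ :=
    le_of_tendsto hlim_sub.norm <| (hmem y x).mono fun F ⟨hy, hx⟩ => (hψF F y hy x hx).2 i
  calc RCLike.re ⟪(A i - ψ₀ (gen B i)) x, y⟫_ℂ
      ≤ ‖⟪(A i - ψ₀ (gen B i)) x, y⟫_ℂ‖ := RCLike.re_le_norm _
    _ = ‖⟪y, (A i - ψ₀ (gen B i)) x⟫_ℂ‖ := norm_inner_symm _ _
    _ ≤ t := by simpa only [hx, hy, mul_one] using hle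

theorem drDTo_le_dmrTo (A : Fin d → H →L[ℂ] H) (B : Fin d → K →L[ℂ] K) :
    drDTo A B ≤ dmrTo A B := by
  refine le_of_forall_gt_imp_ge_of_dense fun r hr => ?_
  obtain ⟨t, ht, htr⟩ := ENNReal.lt_iff_exists_nnreal_btwn.1 hr
  obtain ⟨X, hX, hAX⟩ := exists_isUCPImage_norm_sub_le ht
  calc drDTo A B ≤ ‖A - X‖ₑ :=
        sInf_le ⟨H, _, _, inferInstance, A, X, Equivalent.refl A, hX.dilatesTo, rfl⟩
    _ ≤ t := by exact_mod_cast hAX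
    _ ≤ r := htr.le

theorem dmrTo_eq_drDTo (A : Fin d → H →L[ℂ] H) (B : Fin d → K →L[ℂ] K) :
    dmrTo A B = drDTo A B :=
  le_antisymm (dmrTo_le_drDTo A B) (drDTo_le_dmrTo A B)

end UpperBound

end OperatorTuple

end

theorem corollary1p3 {d : ℕ}
    {H : Type u} [NormedAddCommGroup H] [InnerProductSpace ℂ H] [CompleteSpace H]
    {K : Type u} [NormedAddCommGroup K] [InnerProductSpace ℂ K] [CompleteSpace K]
    (A : Fin d → H →L[ℂ] H) (B : Fin d → K →L[ℂ] K) :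
    OperatorTuple.dmrTo A B = OperatorTuple.drDTo A B ∧
      OperatorTuple.dmr A B = OperatorTuple.drD A B := by
  refine ⟨OperatorTuple.dmrTo_eq_drDTo A B, ?_⟩
  rw [OperatorTuple.dmr_eq_max, OperatorTuple.drD, OperatorTuple.dmrTo_eq_drDTo A B,
    OperatorTuple.dmrTo_eq_drDTo B A]
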